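/- Let $L=\{+,\times,-,0,1,<\}$ be the first-order language of ordered fields and let $\mathrm{OF}$ be the $L$-theory of ordered fields (the field axioms, together with axioms saying that $<$ is a strict linear order such that $x<y$ implies $x+z<y+z$, and $0<x$, $0<y$ imply $0<xy$). Let $\mathrm{IVT}$ be the first-order scheme consisting, for every $m\in\mathbb{N}$, of the sentence $$\forall a_0\cdots\forall a_m\,\forall u\,\forall v\,\exists x\,\bigl[\,u<v\wedge p(u)\cdot p(v)<0\;\rightarrow\;u<x\wedge x<v\wedge p(x)=0\,\bigr],\qquad p(x)=\sum_{i\le m}a_i x^i .$$ Then the theory $\mathrm{OF}+\mathrm{IVT}$ is complete: it is satisfiable, and for every $L$-sentence $\theta$, either $\theta$ or $\neg\theta$ is a logical consequence of $\mathrm{OF}+\mathrm{IVT}$ (that is, holds in all of its models; equivalently, by Gödel's completeness theorem, is provable from it). -/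

import Mathlib

namespace OrderedFieldIVT

open FirstOrder

/-- The relation symbols of the language of ordered fields: only the binary symbol `<`. -/
inductive OrdRel : ℕ → Type
  | lt : OrdRel 2

/-- The first-order language of ordered fields `{+, ×, -, 0, 1, <}`. The function symbols are those
of Mathlib's language of rings. -/
def orderedFieldLang : FirstOrder.Language.{0, 0} where
  Functions := ringFunc
  Relations := OrdRel

section Terms

variable {α : Type*}

instance : Add (orderedFieldLang.Term α) where
  add := FirstOrder.Language.Functions.apply₂ (L := orderedFieldLang) ringFunc.add

instance : Mul (orderedFieldLang.Term α) where
  mul := FirstOrder.Language.Functions.apply₂ (L := orderedFieldLang) ringFunc.mul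

instance : Neg (orderedFieldLang.Term α) where
  neg := FirstOrder.Language.Functions.apply₁ (L := orderedFieldLang) ringFunc.neg

instance : Zero (orderedFieldLang.Term α) where
  zero := FirstOrder.Language.Constants.term (L := orderedFieldLang) ringFunc.zero

instance : One (orderedFieldLang.Term α) where
  one := FirstOrder.Language.Constants.term (L := orderedFieldLang) ringFunc.one

/-- The term `t ^ n`. -/
def powTerm (t : orderedFieldLang.Term α) : ℕ → orderedFieldLang.Term α
  | 0 => 1
  | n + 1 => powTerm t n * t

/-- The term `∑_{i ≤ m} aᵢ xⁱ`. -/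
def polyTerm {m : ℕ} (a : Fin (m + 1) → orderedFieldLang.Term α) (x : orderedFieldLang.Term α) :
    orderedFieldLang.Term α :=
  (List.ofFn fun i : Fin (m + 1) => a i * powTerm x i).sum

/-- The atomic formula `s < t`. -/
def ltF {n : ℕ} (s t : orderedFieldLang.Term (α ⊕ Fin n)) : orderedFieldLang.BoundedFormula α n :=
  FirstOrder.Language.Relations.boundedFormula₂ (L := orderedFieldLang) OrdRel.lt s t

end Terms

/-- The inclusion of the language of rings into the language of ordered fields. -/
def ringInclusion : FirstOrder.Language.ring →ᴸ orderedFieldLang where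
  onFunction := fun _ f => f
  onRelation := fun _ r => r.elim

/-- The axioms saying that `<` is a strict linear order compatible with addition and
multiplication. -/
inductive OrderAxiom : Type
  | irrefl
  | trans
  | trichotomy
  | addLtAdd
  | mulPos

/-- The sentence expressing each order axiom. -/
def OrderAxiom.toSentence : OrderAxiom → orderedFieldLang.Sentence
  | .irrefl => ∀' ∼(ltF (&0) (&0))
  | .trans => ∀' ∀' ∀' (ltF (&0) (&1) ⟹ ltF (&1) (&2) ⟹ ltF (&0) (&2))
  | .trichotomy => ∀' ∀' (ltF (&0) (&1) ⊔ ((&0) =' (&1)) ⊔ ltF (&1) (&0))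
  | .addLtAdd => ∀' ∀' ∀' (ltF (&0) (&1) ⟹ ltF ((&0) + (&2)) ((&1) + (&2)))
  | .mulPos => ∀' ∀' (ltF 0 (&0) ⟹ ltF 0 (&1) ⟹ ltF 0 ((&0) * (&1)))

/-- `OF`: the first-order theory of ordered fields. -/
def OF : orderedFieldLang.Theory :=
  ringInclusion.onTheory FirstOrder.Language.Theory.field ∪ Set.range OrderAxiom.toSentence

/-- The instance of the intermediate value scheme for polynomials `p(x) = ∑_{i ≤ m} aᵢ xⁱ`:
`∀ a₀ … aₘ ∀ u v ∃ x [u < v ∧ p(u) * p(v) < 0 → u < x ∧ x < v ∧ p(x) = 0]`.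
The bound variables are, in this order, `a₀, …, aₘ, u, v, x`. -/
def ivtSentence (m : ℕ) : orderedFieldLang.Sentence :=
  let var (i : Fin (m + 4)) : orderedFieldLang.Term (Empty ⊕ Fin (m + 4)) :=
    FirstOrder.Language.Term.var (Sum.inr i)
  let a (i : Fin (m + 1)) := var ⟨i, by omega⟩
  let u := var ⟨m + 1, by omega⟩
  let v := var ⟨m + 2, by omega⟩
  let x := var ⟨m + 3, by omega⟩
  FirstOrder.Language.BoundedFormula.alls (n := m + 3)
    (∃' ((ltF u v ⊓ ltF (polyTerm a u * polyTerm a v) 0) ⟹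
      (ltF u x ⊓ ltF x v ⊓ (polyTerm a x =' 0))))

/-- The intermediate value theorem for polynomials, as a first-order scheme. -/
def IVT : orderedFieldLang.Theory :=
  Set.range ivtSentence

end OrderedFieldIVT

/-!
The proof is a back-and-forth argument between any two models which keeps track of the signs of
finitely many polynomials only, so that neither saturation nor the existence and uniqueness of real
closures is needed.

For tuples `x` in `M` and `y` in `N` and a finite set `S` of integer polynomials, say that `x` and
`y` agree on `S` if every member of `S` has the same sign at `x` and at `y`. The claim is that for
every formula there is a finite `S` such that tuples agreeing on `S`, in any two models, satisfy the
formula simultaneously (`exists_finset_realize_iff`). For a sentence `S` consists of integers, whose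
signs are the same in all ordered fields, so that every model agrees with `ℝ`, which is itself a
model.

The quantifier step needs, for every finite `S` in the variables `x₁, …, xₙ, X`, a finite `S'` in
`x₁, …, xₙ` such that agreement of `x` and `y` on `S'` allows every `a` to be answered by some `b`
with `(x, a)` and `(y, b)` agreeing on `S` (`exists_finset_back_and_forth`). Here `S` is first
enlarged to a finite set `A` closed under differentiation in `X`, removal of leading terms, and
pseudo-division (`exists_isClosedFamily`), and `S'` is the set of leading coefficients of members of
`A`. If these have the same signs in `M` and `N`, the roots of the members of `A` in `M` correspond
to those in `N` in an order preserving way that determines all signs (`exists_matchesRoots`). This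
is proved by adding the members `p` of `A` in order of increasing degree. The sign of `p` at a root
of an earlier `q` is determined by the sign of a pseudo-remainder of `p` modulo `q`. Between
consecutive roots of earlier members `p` is strictly monotone, because its derivative is one of
them; so its roots there are determined by the signs of `p` at the endpoints
(`IsMatching.exists_extension`). The analysis used is Rolle's theorem and the mean value theorem for
polynomials, which follow from the intermediate value property.
-/

namespace OrderedFieldIVT

open Polynomial SignType

/-! ### Ordered fields with the intermediate value property for polynomials -/

/-- The ordered field `K` has the intermediate value property for polynomials. -/
def PolynomialIVT (K : Type*) [Field K] [LinearOrder K] : Prop :=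
  ∀ (p : K[X]) (u v : K), u < v → p.eval u * p.eval v < 0 → ∃ x, u < x ∧ x < v ∧ p.eval x = 0

section IVT

variable {K : Type*} [Field K] [LinearOrder K] [IsStrictOrderedRing K]

theorem mul_neg_of_sign_ne {a b : K} (ha : a ≠ 0) (hb : b ≠ 0) (h : sign a ≠ sign b) :
    a * b < 0 := by
  rcases lt_or_gt_of_ne ha with ha | ha <;> rcases lt_or_gt_of_ne hb with hb | hb
  · simp [sign_neg ha, sign_neg hb] at h
  · exact mul_neg_of_neg_of_pos ha hb
  · exact mul_neg_of_pos_of_neg ha hb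
  · simp [sign_pos ha, sign_pos hb] at h

theorem PolynomialIVT.sign_eval_eq (hK : PolynomialIVT K) {p : K[X]} {x y : K} (hxy : x < y)
    (h : ∀ c, x < c → c < y → p.eval c ≠ 0) (hx : p.eval x ≠ 0) (hy : p.eval y ≠ 0) :
    sign (p.eval x) = sign (p.eval y) := by
  by_contra hne
  obtain ⟨c, h1, h2, h3⟩ := hK p x y hxy (mul_neg_of_sign_ne hx hy hne)
  exact h c h1 h2 h3

/-- Rolle's theorem between consecutive roots: writing `p = (X - a) ^ m * (X - b) ^ n * q`, the
cofactor of `(X - a) ^ (m - 1) * (X - b) ^ (n - 1)` in `p'` takes values of opposite signs at `a`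
and `b`. -/
theorem PolynomialIVT.exists_derivative_eq_zero_of_consecutive (hK : PolynomialIVT K) {p : K[X]}
    (hp : p ≠ 0) {a b : K} (hab : a < b) (ha : p.eval a = 0) (hb : p.eval b = 0)
    (h : ∀ c, a < c → c < b → p.eval c ≠ 0) :
    ∃ c, a < c ∧ c < b ∧ p.derivative.eval c = 0 := by
  obtain ⟨r, hr, hra⟩ := exists_eq_pow_rootMultiplicity_mul_and_not_dvd p hp a
  have hm : 0 < p.rootMultiplicity a := (rootMultiplicity_pos hp).2 ha
  obtain ⟨m, hm⟩ := Nat.exists_eq_succ_of_ne_zero hm.ne'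
  rw [hm] at hr
  have hr0 : r ≠ 0 := by rintro rfl; simp at hra
  have hrb : r.eval b = 0 := by
    rw [hr] at hb
    simpa [sub_ne_zero.2 hab.ne'] using hb
  obtain ⟨q, hq, hqb⟩ := exists_eq_pow_rootMultiplicity_mul_and_not_dvd r hr0 b
  have hn : 0 < r.rootMultiplicity b := (rootMultiplicity_pos hr0).2 hrb
  obtain ⟨n, hn⟩ := Nat.exists_eq_succ_of_ne_zero hn.ne'
  rw [hn] at hq
  rw [dvd_iff_isRoot, IsRoot.def] at hqb hra
  have hqa : q.eval a ≠ 0 := by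
    rw [hq] at hra
    simp at hra
    tauto
  have hsign : sign (q.eval a) = sign (q.eval b) := by
    refine hK.sign_eval_eq hab (fun c h1 h2 h3 => h c h1 h2 ?_) hqa hqb
    rw [hr, hq]
    simp [h3]
  set q1 : K[X] := C ((m : K) + 1) * (X - C b) * q + C ((n : K) + 1) * (X - C a) * q +
    (X - C a) * (X - C b) * q.derivative with hq1
  have hpos : 0 < q.eval a * q.eval b := by
    rcases lt_or_gt_of_ne hqa with h1 | h1 <;> rcases lt_or_gt_of_ne hqb with h2 | h2
    · exact mul_pos_of_neg_of_neg h1 h2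
    · simp [sign_neg h1, sign_pos h2] at hsign
    · simp [sign_neg h2, sign_pos h1] at hsign
    · exact mul_pos h1 h2
  have hneg : q1.eval a * q1.eval b < 0 := by
    have : q1.eval a * q1.eval b =
        -(((m : K) + 1) * ((n : K) + 1) * (b - a) ^ 2 * (q.eval a * q.eval b)) := by
      simp [hq1]
      ring
    rw [this, neg_lt_zero]
    have := sub_pos.2 hab
    positivity
  obtain ⟨c, h1, h2, h3⟩ := hK q1 a b hab hneg
  refine ⟨c, h1, h2, ?_⟩
  have : p.derivative = (X - C a) ^ m * (X - C b) ^ n * q1 := by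
    rw [hr, hq, hq1]
    simp [derivative_mul, derivative_pow]
    ring
  rw [this]
  simp [h3]

/-- Rolle's theorem. -/
theorem PolynomialIVT.exists_derivative_eq_zero (hK : PolynomialIVT K) {p : K[X]} {a b : K}
    (hab : a < b) (ha : p.eval a = 0) (hb : p.eval b = 0) :
    ∃ c, a < c ∧ c < b ∧ p.derivative.eval c = 0 := by
  classical
  by_cases hp : p = 0
  · obtain ⟨c, h1, h2⟩ := exists_between hab
    exact ⟨c, h1, h2, by simp [hp]⟩
  -- The least root of `p` above `a`.
  obtain ⟨d, hd, hmin⟩ := (p.roots.toFinset.filter (a < ·)).exists_min_image id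
    ⟨b, by simp [hp, hb, hab]⟩
  simp only [Finset.mem_filter, Multiset.mem_toFinset, mem_roots hp, IsRoot.def, id] at hd hmin
  obtain ⟨c, h1, h2, h3⟩ := hK.exists_derivative_eq_zero_of_consecutive hp hd.2 ha hd.1
    (fun c h1 h2 h3 => (hmin c ⟨h3, h1⟩).not_gt h2)
  exact ⟨c, h1, h2.trans_le (hmin b ⟨hb, hab⟩), h3⟩

/-- The mean value theorem. -/
theorem PolynomialIVT.exists_eval_sub_eval (hK : PolynomialIVT K) (p : K[X]) {a b : K}
    (hab : a < b) :
    ∃ c, a < c ∧ c < b ∧ p.eval b - p.eval a = (b - a) * p.derivative.eval c := by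
  obtain ⟨c, h1, h2, h3⟩ := hK.exists_derivative_eq_zero
    (p := C (b - a) * (p - C (p.eval a)) - C (p.eval b - p.eval a) * (X - C a)) hab
    (by simp) (by simp; ring)
  refine ⟨c, h1, h2, ?_⟩
  simp at h3
  linear_combination -h3

/-- A polynomial with a root strictly between `a` and `b` changes sign there if its derivative has
no root. -/
theorem PolynomialIVT.eval_mul_eval_neg (hK : PolynomialIVT K) {p : K[X]} {a r b : K}
    (har : a < r) (hrb : r < b) (hr : p.eval r = 0)
    (h : ∀ c, a < c → c < b → p.derivative.eval c ≠ 0) : p.eval a * p.eval b < 0 := by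
  obtain ⟨c, hc1, hc2, hc⟩ := hK.exists_eval_sub_eval p har
  obtain ⟨d, hd1, hd2, hd⟩ := hK.exists_eval_sub_eval p hrb
  have hs := hK.sign_eval_eq (p := p.derivative) (hc2.trans hd1)
    (fun e h1 h2 => h e (hc1.trans h1) (h2.trans hd2)) (h c hc1 (hc2.trans hrb))
    (h d (har.trans hd1) hd2)
  have hpos : 0 < p.derivative.eval c * p.derivative.eval d := by
    rcases lt_or_gt_of_ne (h c hc1 (hc2.trans hrb)) with h1 | h1 <;>
      rcases lt_or_gt_of_ne (h d (har.trans hd1) hd2) with h2 | h2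
    · exact mul_pos_of_neg_of_neg h1 h2
    · simp [sign_neg h1, sign_pos h2] at hs
    · simp [sign_neg h2, sign_pos h1] at hs
    · exact mul_pos h1 h2
  have : p.eval a * p.eval b =
      -((r - a) * (b - r) * (p.derivative.eval c * p.derivative.eval d)) := by
    rw [hr] at hc hd
    linear_combination (-p.eval b) * hc - (r - a) * p.derivative.eval c * hd
  rw [this, neg_lt_zero]
  have := sub_pos.2 har
  have := sub_pos.2 hrb
  positivity

/-! ### Signs near infinity -/

/-- A polynomial with positive leading coefficient is bounded below by a positive constant near
infinity. The bound, stronger than positivity, is what carries the induction on the degree through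
`p = p.divX * X + C (p.coeff 0)`. -/
theorem exists_forall_ge_le_eval (n : ℕ) (p : K[X]) (hn : p.natDegree = n)
    (hp : 0 < p.leadingCoeff) : ∃ δ > 0, ∃ B, ∀ x, B ≤ x → δ ≤ p.eval x := by
  induction n generalizing p with
  | zero =>
    rw [eq_C_of_natDegree_eq_zero hn] at hp ⊢
    exact ⟨p.coeff 0, by simpa using hp, 0, fun x _ => by simp⟩
  | succ n ih =>
    have hd : p.divX.natDegree = n := by rw [natDegree_divX_eq_natDegree_tsub_one, hn]; rfl
    have hl : p.divX.leadingCoeff = p.leadingCoeff := by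
      rw [leadingCoeff, leadingCoeff, hd, hn, coeff_divX]
    obtain ⟨δ, hδ, B, hB⟩ := ih p.divX hd (hl ▸ hp)
    refine ⟨1, one_pos, max B ((1 + |p.coeff 0|) / δ), fun x hx => ?_⟩
    have h1 := hB x ((le_max_left _ _).trans hx)
    have h2 : 1 + |p.coeff 0| ≤ x * δ := (div_le_iff₀ hδ).1 ((le_max_right _ _).trans hx)
    have h3 : 0 ≤ x := le_trans (by positivity) ((le_max_right _ _).trans hx)
    rw [← divX_mul_X_add p]
    simp only [eval_add, eval_mul, eval_X, eval_C]
    nlinarith [neg_abs_le (p.coeff 0), mul_le_mul_of_nonneg_left h1 h3]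

theorem exists_forall_ge_sign_eval (p : K[X]) :
    ∃ B, ∀ x, B ≤ x → sign (p.eval x) = sign p.leadingCoeff := by
  rcases lt_trichotomy p.leadingCoeff 0 with h | h | h
  · obtain ⟨δ, hδ, B, hB⟩ := exists_forall_ge_le_eval _ (-p) rfl (by simpa using h)
    refine ⟨B, fun x hx => ?_⟩
    have := hδ.trans_le (hB x hx)
    rw [sign_neg h, sign_neg (by simpa using this)]
  · exact ⟨0, fun x _ => by simp [leadingCoeff_eq_zero.1 h]⟩
  · obtain ⟨δ, hδ, B, hB⟩ := exists_forall_ge_le_eval _ p rfl h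
    exact ⟨B, fun x hx => by rw [sign_pos h, sign_pos (hδ.trans_le (hB x hx))]⟩

theorem exists_forall_le_sign_eval (p : K[X]) :
    ∃ B, ∀ x, x ≤ B → sign (p.eval x) = sign ((-1) ^ p.natDegree * p.leadingCoeff) := by
  obtain ⟨B, hB⟩ := exists_forall_ge_sign_eval (p.comp (-X))
  refine ⟨-B, fun x hx => ?_⟩
  rw [← comp_neg_X_leadingCoeff_eq, ← hB (-x) (le_neg_of_le_neg hx)]
  simp

end IVT

/-! ### Pseudo-division and sets of polynomials closed under it -/

section PseudoDivision

variable {R : Type*} [CommRing R]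

theorem exists_pseudo_remainder (p q : R[X]) (hq : 1 ≤ q.natDegree) :
    ∃ (k : ℕ) (s r : R[X]),
      C (q.leadingCoeff ^ k) * p = q * s + r ∧ r.natDegree < q.natDegree := by
  induction hn : p.natDegree using Nat.strong_induction_on generalizing p with
  | _ n ih =>
    subst hn
    by_cases hlt : p.natDegree < q.natDegree
    · exact ⟨0, 0, p, by simp, hlt⟩
    push Not at hlt
    set p' := C q.leadingCoeff * p - q * (C p.leadingCoeff * X ^ (p.natDegree - q.natDegree))
      with hp'
    have hdeg : p'.natDegree < p.natDegree := by
      have h1 : p'.natDegree ≤ p.natDegree := by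
        refine (natDegree_sub_le _ _).trans (max_le (natDegree_C_mul_le _ _) ?_)
        refine natDegree_mul_le.trans ?_
        have := natDegree_C_mul_X_pow_le p.leadingCoeff (p.natDegree - q.natDegree)
        omega
      have h2 : p'.coeff p.natDegree = 0 := by
        obtain ⟨d, hd⟩ := Nat.exists_eq_add_of_le hlt
        have : p.natDegree - q.natDegree = d := by omega
        rw [hp', this, ← mul_assoc, coeff_sub, coeff_C_mul, hd, coeff_mul_X_pow, coeff_mul_C, ← hd,
          coeff_natDegree, coeff_natDegree, sub_self]
      refine lt_of_le_of_ne h1 fun h3 => ?_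
      rw [← h3, coeff_natDegree, leadingCoeff_eq_zero] at h2
      rw [h2, natDegree_zero] at h3
      omega
    obtain ⟨k, s, r, h, hr⟩ := ih _ hdeg p' rfl
    refine ⟨k + 1, s + C (q.leadingCoeff ^ k) *
      (C p.leadingCoeff * X ^ (p.natDegree - q.natDegree)), r, ?_, hr⟩
    rw [hp'] at h
    simp only [map_pow] at h ⊢
    linear_combination h

open Classical in
/-- A pseudo-remainder of `p` modulo `q`: its degree is below that of `q`, and it is congruent
modulo `q` to the product of `p` with a power of the leading coefficient of `q`. The value is `0`
if `q` is constant. -/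
noncomputable def pseudoRem (p q : R[X]) : R[X] :=
  if hq : 1 ≤ q.natDegree then (exists_pseudo_remainder p q hq).choose_spec.choose_spec.choose
  else 0

theorem pseudoRem_spec (p q : R[X]) (hq : 1 ≤ q.natDegree) :
    ∃ (k : ℕ) (s : R[X]), C (q.leadingCoeff ^ k) * p = q * s + pseudoRem p q :=
  ⟨_, _, by
    rw [pseudoRem, dif_pos hq]
    exact (exists_pseudo_remainder p q hq).choose_spec.choose_spec.choose_spec.1⟩

theorem natDegree_pseudoRem_lt (p q : R[X]) (hq : 1 ≤ q.natDegree) :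
    (pseudoRem p q).natDegree < q.natDegree := by
  rw [pseudoRem, dif_pos hq]
  exact (exists_pseudo_remainder p q hq).choose_spec.choose_spec.choose_spec.2

/-- A finite set generates a finite set under a binary operation (with finite sets of values) whose
values have smaller degree than both arguments. -/
theorem exists_finset_closed {α : Type*} (deg : α → ℕ) (F : α → α → Finset α)
    (hF : ∀ p q, ∀ r ∈ F p q, deg r < deg p ∧ deg r < deg q) (S : Finset α) :
    ∃ A : Finset α, S ⊆ A ∧ ∀ p ∈ A, ∀ q ∈ A, F p q ⊆ A := by
  classical
  set B := S.sup deg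
  -- By induction on `k`, closure can be achieved for the pairs of degree above `B - k`.
  have key : ∀ k : ℕ, ∃ A : Finset α, S ⊆ A ∧ (∀ p ∈ A, deg p ≤ B) ∧
      ∀ p ∈ A, ∀ q ∈ A, B < deg p + k → B < deg q + k → F p q ⊆ A := by
    intro k
    induction k with
    | zero =>
      exact ⟨S, subset_rfl, fun p hp => Finset.le_sup hp, fun p hp q _ h _ =>
        absurd (Finset.le_sup (f := deg) hp) (by simpa using h)⟩
    | succ k ih =>
      obtain ⟨A, hSA, hAB, hA⟩ := ih
      refine ⟨A ∪ (A ×ˢ A).biUnion fun z =>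
        if B ≤ deg z.1 + k ∧ B ≤ deg z.2 + k then F z.1 z.2 else ∅,
        hSA.trans Finset.subset_union_left, ?_, ?_⟩
      · intro p hp
        simp only [Finset.mem_union, Finset.mem_biUnion, Finset.mem_product, Prod.exists] at hp
        rcases hp with hp | ⟨a, b, ⟨ha, _⟩, hp⟩
        · exact hAB p hp
        · split_ifs at hp
          · exact (hF _ _ _ hp).1.le.trans (hAB a ha)
          · simp at hp
      · have hnew : ∀ p ∈ A ∪ (A ×ˢ A).biUnion fun z =>
            if B ≤ deg z.1 + k ∧ B ≤ deg z.2 + k then F z.1 z.2 else ∅, B < deg p + (k + 1) →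
            p ∈ A := by
          intro p hp hlt
          simp only [Finset.mem_union, Finset.mem_biUnion, Finset.mem_product, Prod.exists] at hp
          rcases hp with hp | ⟨a, b, ⟨ha, hb⟩, hp⟩
          · exact hp
          · split_ifs at hp with hab
            · by_cases hgt : B < deg a + k ∧ B < deg b + k
              · exact hA a ha b hb hgt.1 hgt.2 hp
              · have := hF _ _ _ hp
                omega
            · simp at hp
        intro p hp q hq hpk hqk r hr
        refine Finset.mem_union_right _ (Finset.mem_biUnion.2 ⟨(p, q), ?_, ?_⟩)
        · exact Finset.mem_product.2 ⟨hnew p hp hpk, hnew q hq hqk⟩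
        · rw [if_pos ⟨by simp; omega, by simp; omega⟩]
          exact hr
  obtain ⟨A, hSA, _, hA⟩ := key (B + 1)
  exact ⟨A, hSA, fun p hp q hq => hA p hp q hq (by omega) (by omega)⟩

/-- A set of polynomials is closed if, with every nonconstant `q`, it contains the derivative of
`q`, the polynomial `q` without its leading term, and the pseudo-remainders modulo `q` of the
members whose degree is at least that of `q`. -/
def IsClosedFamily (A : Finset R[X]) : Prop :=
  ∀ q ∈ A, 1 ≤ q.natDegree → derivative q ∈ A ∧ q.eraseLead ∈ A ∧
    ∀ p ∈ A, q.natDegree ≤ p.natDegree → pseudoRem p q ∈ A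

theorem natDegree_eraseLead_lt_of_one_le {q : R[X]} (hq : 1 ≤ q.natDegree) :
    q.eraseLead.natDegree < q.natDegree := by
  have := eraseLead_natDegree_le q
  omega

theorem exists_isClosedFamily (S : Finset R[X]) : ∃ A, S ⊆ A ∧ IsClosedFamily A := by
  classical
  obtain ⟨A, hSA, hA⟩ := exists_finset_closed (α := R[X]) natDegree
    (fun p q => if 1 ≤ q.natDegree ∧ q.natDegree ≤ p.natDegree then
      {derivative q, q.eraseLead, pseudoRem p q} else ∅) (by
      intro p q r hr
      split_ifs at hr with h
      · suffices r.natDegree < q.natDegree from ⟨this.trans_le h.2, this⟩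
        simp only [Finset.mem_insert, Finset.mem_singleton] at hr
        rcases hr with rfl | rfl | rfl
        · exact natDegree_derivative_lt (by omega)
        · exact natDegree_eraseLead_lt_of_one_le h.1
        · exact natDegree_pseudoRem_lt p q h.1
      · simp at hr) S
  refine ⟨A, hSA, fun q hq h1 => ?_⟩
  have h2 := hA q hq q hq
  rw [if_pos ⟨h1, le_rfl⟩] at h2
  refine ⟨h2 (by simp), h2 (by simp), fun p hp hle => ?_⟩
  have h3 := hA p hp q hq
  rw [if_pos ⟨h1, hle⟩] at h3
  exact h3 (by simp)

end PseudoDivision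

/-! ### Matchings between two ordered fields -/

section SameCut

variable {M N : Type*} [LinearOrder M] [LinearOrder N]

/-- The points `a` and `b` lie in the same position relative to the first, respectively the second,
coordinates of the members of `Z`. -/
def SameCut (Z : Set (M × N)) (a : M) (b : N) : Prop :=
  ∀ z ∈ Z, (z.1 < a ↔ z.2 < b) ∧ (a < z.1 ↔ b < z.2)

theorem SameCut.mono {Z Z' : Set (M × N)} (h : Z ⊆ Z') {a : M} {b : N} (hab : SameCut Z' a b) :
    SameCut Z a b :=
  fun z hz => hab z (h hz)

theorem SameCut.swap {Z : Set (M × N)} {a : M} {b : N} (h : SameCut Z a b) :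
    SameCut (Prod.swap ⁻¹' Z) b a :=
  fun z hz => ⟨(h z.swap hz).1.symm, (h z.swap hz).2.symm⟩

theorem SameCut.eq_of_mem {Z : Set (M × N)} {a : M} {b b' : N} (h : SameCut Z a b)
    (hz : (a, b') ∈ Z) : b = b' := by
  have := h _ hz
  simp only [lt_self_iff_false, false_iff, not_lt] at this
  exact le_antisymm this.1 this.2

/-- A finite order isomorphism between a subset of `M` and a subset of `N`, given as its graph. -/
structure IsMatching (Z : Set (M × N)) : Prop where
  finite : Z.Finite
  sameCut : ∀ z ∈ Z, SameCut Z z.1 z.2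

theorem IsMatching.empty : IsMatching (∅ : Set (M × N)) :=
  ⟨Set.finite_empty, by simp⟩

theorem IsMatching.swap {Z : Set (M × N)} (hZ : IsMatching Z) : IsMatching (Prod.swap ⁻¹' Z) :=
  ⟨hZ.finite.preimage Prod.swap_injective.injOn, fun z hz => (hZ.sameCut z.swap hz).swap⟩

end SameCut

/-- Since `N` is densely ordered without endpoints, every position relative to a finite matching is
occupied. -/
theorem IsMatching.exists_sameCut {M N : Type*} [LinearOrder M] [Field N] [LinearOrder N]
    [IsStrictOrderedRing N] {Z : Set (M × N)} (hZ : IsMatching Z) (a : M) : ∃ b, SameCut Z a b := by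
  classical
  by_cases ha : ∃ b, (a, b) ∈ Z
  · obtain ⟨b, hb⟩ := ha
    exact ⟨b, hZ.sameCut _ hb⟩
  push Not at ha
  obtain ⟨m, h1, h2⟩ := Order.exists_between_finsets
    ((hZ.finite.toFinset.filter (·.1 < a)).image Prod.snd)
    ((hZ.finite.toFinset.filter (a < ·.1)).image Prod.snd) (by
      simp only [Finset.mem_image, Finset.mem_filter, Set.Finite.mem_toFinset]
      rintro _ ⟨x, ⟨hx, hxa⟩, rfl⟩ _ ⟨y, ⟨hy, hya⟩, rfl⟩
      exact (hZ.sameCut y hy x hx).1.1 (hxa.trans hya))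
  simp only [Finset.mem_image, Finset.mem_filter, Set.Finite.mem_toFinset] at h1 h2
  refine ⟨m, fun z hz => ?_⟩
  rcases lt_trichotomy z.1 a with h | h | h
  · have := h1 z.2 ⟨z, ⟨hz, h⟩, rfl⟩
    simp [h, this, h.not_gt, this.not_gt]
  · subst h
    exact absurd hz (ha z.2)
  · have := h2 z.2 ⟨z, ⟨hz, h⟩, rfl⟩
    simp [h, this, h.not_gt, this.not_gt]

/-- By Rolle's theorem, two roots of `P` are separated by any matching containing the roots of
`P'`. -/
theorem exists_between_roots {M N : Type*} [Field M] [LinearOrder M] [IsStrictOrderedRing M]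
    (hM : PolynomialIVT M) {P : M[X]} {Z : Set (M × N)}
    (hder : ∀ c, P.derivative.eval c = 0 → ∃ d, (c, d) ∈ Z) {a a' : M} (haa : a < a')
    (ha : P.eval a = 0) (ha' : P.eval a' = 0) : ∃ z ∈ Z, a < z.1 ∧ z.1 < a' := by
  obtain ⟨c, h1, h2, h3⟩ := hM.exists_derivative_eq_zero haa ha ha'
  obtain ⟨d, hd⟩ := hder c h3
  exact ⟨_, hd, h1, h2⟩

section Matching

variable {M N : Type*} [Field M] [LinearOrder M] [IsStrictOrderedRing M]
  [Field N] [LinearOrder N] [IsStrictOrderedRing N]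

namespace IsMatching

variable {Z : Set (M × N)}

/-- To the right of corresponding points `a` and `b`, there is a pair of points at which `P` and `Q`
have the same sign, with no member of `Z` in between: either the next member of `Z`, or points so
large that the signs there are those of the leading coefficients. -/
theorem exists_right_endpoint (hZ : IsMatching Z) {P : M[X]} {Q : N[X]}
    (hlc : sign P.leadingCoeff = sign Q.leadingCoeff)
    (hsign : ∀ z ∈ Z, sign (P.eval z.1) = sign (Q.eval z.2)) {a : M} {b : N}
    (hab : SameCut Z a b) :
    ∃ w : M × N, a < w.1 ∧ b < w.2 ∧ sign (P.eval w.1) = sign (Q.eval w.2) ∧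
      ∀ z ∈ Z, a < z.1 → w.1 ≤ z.1 ∧ w.2 ≤ z.2 := by
  by_cases hne : {z ∈ Z | a < z.1}.Nonempty
  · obtain ⟨w, ⟨hw, haw⟩, hmin⟩ :=
      Set.exists_min_image {z ∈ Z | a < z.1} Prod.fst (hZ.finite.subset (Set.sep_subset _ _)) hne
    refine ⟨w, haw, (hab w hw).2.1 haw, hsign w hw, fun z hz haz => ?_⟩
    have := hmin z ⟨hz, haz⟩
    exact ⟨this, not_lt.1 fun h => this.not_gt ((hZ.sameCut w hw z hz).1.2 h)⟩
  · obtain ⟨B, hB⟩ := exists_forall_ge_sign_eval P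
    obtain ⟨B', hB'⟩ := exists_forall_ge_sign_eval Q
    refine ⟨(max B (a + 1), max B' (b + 1)), ?_, ?_, ?_, fun z hz haz => (hne ⟨z, hz, haz⟩).elim⟩
    · exact (lt_add_one a).trans_le (le_max_right _ _)
    · exact (lt_add_one b).trans_le (le_max_right _ _)
    · rw [hB _ (le_max_left _ _), hB' _ (le_max_left _ _), hlc]

/-- The counterpart of `exists_right_endpoint` on the left, where the signs near infinity depend on
the parity of the degree as well. -/
theorem exists_left_endpoint (hZ : IsMatching Z) {P : M[X]} {Q : N[X]}
    (hdeg : P.natDegree = Q.natDegree) (hlc : sign P.leadingCoeff = sign Q.leadingCoeff)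
    (hsign : ∀ z ∈ Z, sign (P.eval z.1) = sign (Q.eval z.2)) {a : M} {b : N}
    (hab : SameCut Z a b) :
    ∃ v : M × N, v.1 < a ∧ v.2 < b ∧ sign (P.eval v.1) = sign (Q.eval v.2) ∧
      ∀ z ∈ Z, z.1 < a → z.1 ≤ v.1 ∧ z.2 ≤ v.2 := by
  by_cases hne : {z ∈ Z | z.1 < a}.Nonempty
  · obtain ⟨w, ⟨hw, haw⟩, hmin⟩ :=
      Set.exists_max_image {z ∈ Z | z.1 < a} Prod.fst (hZ.finite.subset (Set.sep_subset _ _)) hne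
    refine ⟨w, haw, (hab w hw).1.1 haw, hsign w hw, fun z hz haz => ?_⟩
    have := hmin z ⟨hz, haz⟩
    exact ⟨this, not_lt.1 fun h => this.not_gt ((hZ.sameCut w hw z hz).2.2 h)⟩
  · obtain ⟨B, hB⟩ := exists_forall_le_sign_eval P
    obtain ⟨B', hB'⟩ := exists_forall_le_sign_eval Q
    refine ⟨(min B (a - 1), min B' (b - 1)), ?_, ?_, ?_, fun z hz haz => (hne ⟨z, hz, haz⟩).elim⟩
    · exact (min_le_right _ _).trans_lt (sub_one_lt a)
    · exact (min_le_right _ _).trans_lt (sub_one_lt b)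
    · rw [hB _ (min_le_left _ _), hB' _ (min_le_left _ _), hdeg, sign_mul, sign_mul, hlc]
      rcases neg_one_pow_eq_or M Q.natDegree with h | h <;>
        rcases Nat.even_or_odd Q.natDegree with h' | h' <;> simp [h'.neg_one_pow]

/-- If `Z` contains the roots of `P'`, then a root of `P` gives a root of `Q` in the corresponding
interval: `P` changes sign between the endpoints of its interval, so `Q` does as well. -/
theorem exists_root_sameCut (hM : PolynomialIVT M) (hN : PolynomialIVT N) (hZ : IsMatching Z)
    {P : M[X]} {Q : N[X]}
    (hdeg : P.natDegree = Q.natDegree) (hlc : sign P.leadingCoeff = sign Q.leadingCoeff)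
    (hsign : ∀ z ∈ Z, sign (P.eval z.1) = sign (Q.eval z.2))
    (hder : ∀ c, P.derivative.eval c = 0 → ∃ d, (c, d) ∈ Z) {a : M} (ha : P.eval a = 0) :
    ∃ b, Q.eval b = 0 ∧ SameCut Z a b := by
  by_cases haZ : ∃ b, (a, b) ∈ Z
  · obtain ⟨b, hb⟩ := haZ
    refine ⟨b, ?_, hZ.sameCut _ hb⟩
    have := hsign _ hb
    rwa [ha, sign_zero, eq_comm, sign_eq_zero_iff] at this
  obtain ⟨b₀, hb₀⟩ := hZ.exists_sameCut a
  obtain ⟨w, haw, hbw, hw, hwZ⟩ := hZ.exists_right_endpoint hlc hsign hb₀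
  obtain ⟨v, hva, hvb, hv, hvZ⟩ := hZ.exists_left_endpoint hdeg hlc hsign hb₀
  have hneg : P.eval v.1 * P.eval w.1 < 0 := by
    refine hM.eval_mul_eval_neg hva haw ha fun c h1 h2 h3 => ?_
    obtain ⟨d, hd⟩ := hder c h3
    rcases lt_trichotomy c a with h | h | h
    · exact ((hvZ _ hd h).1).not_gt h1
    · exact haZ ⟨d, h ▸ hd⟩
    · exact ((hwZ _ hd h).1).not_gt h2
  have hneg' : Q.eval v.2 * Q.eval w.2 < 0 := by
    rw [← sign_eq_neg_one_iff, sign_mul] at hneg ⊢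
    rw [← hv, ← hw, hneg]
  obtain ⟨b, h1, h2, h3⟩ := hN Q v.2 w.2 (hvb.trans hbw) hneg'
  refine ⟨b, h3, fun z hz => ?_⟩
  rcases lt_trichotomy z.1 a with h | h | h
  · have := (hvZ z hz h).2.trans_lt h1
    simp [h, this, h.not_gt, this.not_gt]
  · exact absurd ⟨z.2, h ▸ hz⟩ haZ
  · have := h2.trans_le (hwZ z hz h).2
    simp [h, this, h.not_gt, this.not_gt]

/-- A matching which contains the roots of `P'` and `Q'` and respects the signs of `P` and `Q`
extends by the roots of `P` and `Q`; the extended matching determines the signs of `P` and `Q`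
everywhere. -/
theorem exists_extension (hM : PolynomialIVT M) (hN : PolynomialIVT N) (hZ : IsMatching Z)
    {P : M[X]} {Q : N[X]} (hP : P ≠ 0) (hQ : Q ≠ 0)
    (hdeg : P.natDegree = Q.natDegree) (hlc : sign P.leadingCoeff = sign Q.leadingCoeff)
    (hsign : ∀ z ∈ Z, sign (P.eval z.1) = sign (Q.eval z.2))
    (hderP : ∀ c, P.derivative.eval c = 0 → ∃ d, (c, d) ∈ Z)
    (hderQ : ∀ d, Q.derivative.eval d = 0 → ∃ c, (c, d) ∈ Z) :
    ∃ Z', Z ⊆ Z' ∧ IsMatching Z' ∧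
      (∀ z ∈ Z', z ∈ Z ∨ P.eval z.1 = 0 ∧ Q.eval z.2 = 0) ∧
      (∀ a, P.eval a = 0 → ∃ b, (a, b) ∈ Z') ∧
      (∀ b, Q.eval b = 0 → ∃ a, (a, b) ∈ Z') ∧
      ∀ a b, SameCut Z' a b → sign (P.eval a) = sign (Q.eval b) := by
  set Z' : Set (M × N) := Z ∪ {z | P.eval z.1 = 0 ∧ Q.eval z.2 = 0 ∧ SameCut Z z.1 z.2} with hZ'
  have hsub : Z ⊆ Z' := Set.subset_union_left
  have hcut : ∀ z ∈ Z', SameCut Z z.1 z.2 := by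
    rintro z (hz | hz)
    exacts [hZ.sameCut z hz, hz.2.2]
  have hnew : ∀ z ∈ Z', z ∈ Z ∨ P.eval z.1 = 0 ∧ Q.eval z.2 = 0 := by
    rintro z (hz | hz)
    exacts [.inl hz, .inr ⟨hz.1, hz.2.1⟩]
  have hsign' : ∀ z ∈ Z', sign (P.eval z.1) = sign (Q.eval z.2) := by
    intro z hz
    rcases hnew z hz with h | h
    exacts [hsign z h, by rw [h.1, h.2, sign_zero, sign_zero]]
  have hrootP : ∀ a, P.eval a = 0 → ∃ b, (a, b) ∈ Z' := by
    intro a ha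
    obtain ⟨b, hb, hab⟩ := hZ.exists_root_sameCut hM hN hdeg hlc hsign hderP ha
    exact ⟨b, .inr ⟨ha, hb, hab⟩⟩
  have hrootQ : ∀ b, Q.eval b = 0 → ∃ a, (a, b) ∈ Z' := by
    intro b hb
    obtain ⟨a, ha, hab⟩ := hZ.swap.exists_root_sameCut hN hM hdeg.symm hlc.symm
      (fun z hz => (hsign z.swap hz).symm) hderQ hb
    exact ⟨a, .inr ⟨ha, hb, hab.swap⟩⟩
  have hlt : ∀ z ∈ Z', ∀ w ∈ Z', (z.1 < w.1 ↔ z.2 < w.2) := by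
    intro z hz w hw
    rcases hnew z hz with h | h
    · exact (hcut w hw z h).1
    rcases hnew w hw with h' | h'
    · exact (hcut z hz w h').2
    constructor
    · intro hlt
      obtain ⟨c, hc, h1, h2⟩ := exists_between_roots hM hderP hlt h.1 h'.1
      exact ((hcut z hz c hc).2.1 h1).trans ((hcut w hw c hc).1.1 h2)
    · intro hlt
      obtain ⟨c, hc, h1, h2⟩ :=
        exists_between_roots (Z := Prod.swap ⁻¹' Z) hN hderQ hlt h.2 h'.2
      exact ((hcut z hz c.swap hc).2.2 h1).trans ((hcut w hw c.swap hc).1.2 h2)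
  have hmatch : IsMatching Z' := by
    refine ⟨?_, fun z hz w hw => ⟨hlt w hw z hz, hlt z hz w hw⟩⟩
    refine hZ.finite.union
      (((P.finite_setOfPred_isRoot hP).prod (Q.finite_setOfPred_isRoot hQ)).subset ?_)
    exact fun z hz => ⟨hz.1, hz.2.1⟩
  refine ⟨Z', hsub, hmatch, hnew, hrootP, hrootQ, fun a b hab => ?_⟩
  by_cases haZ : ∃ b', (a, b') ∈ Z'
  · obtain ⟨b', hb'⟩ := haZ
    obtain rfl := hab.eq_of_mem hb'
    exact hsign' _ hb'
  by_cases hbZ : ∃ a', (a', b) ∈ Z'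
  · obtain ⟨a', ha'⟩ := hbZ
    obtain rfl := hab.swap.eq_of_mem (b' := a') ha'
    exact hsign' _ ha'
  have ha : P.eval a ≠ 0 := fun h => haZ (hrootP a h)
  have hb : Q.eval b ≠ 0 := fun h => hbZ (hrootQ b h)
  obtain ⟨w, haw, hbw, hw, hwZ⟩ := hmatch.exists_right_endpoint hlc hsign' hab
  obtain ⟨v, hva, hvb, hv, hvZ⟩ := hmatch.exists_left_endpoint hdeg hlc hsign' hab
  -- The signs at `a` and `b` are those at an endpoint which is not a root.
  by_cases hw0 : P.eval w.1 = 0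
  · by_cases hv0 : P.eval v.1 = 0
    · obtain ⟨z, hz, h1, h2⟩ := exists_between_roots hM hderP (hva.trans haw) hv0 hw0
      rcases lt_trichotomy z.1 a with h | h | h
      · exact absurd h1 (hvZ z (hsub hz) h).1.not_gt
      · exact absurd ⟨z.2, h ▸ hsub hz⟩ haZ
      · exact absurd h2 (hwZ z (hsub hz) h).1.not_gt
    · have hv0' : Q.eval v.2 ≠ 0 := by rwa [← sign_ne_zero, ← hv, sign_ne_zero]
      rw [← hM.sign_eval_eq hva (fun c h1 h2 h3 => ?_) hv0 ha,
        ← hN.sign_eval_eq hvb (fun c h1 h2 h3 => ?_) hv0' hb, hv]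
      · obtain ⟨d, hd⟩ := hrootQ c h3
        exact (hvZ _ hd ((hab _ hd).1.2 h2)).2.not_gt h1
      · obtain ⟨d, hd⟩ := hrootP c h3
        exact (hvZ _ hd h2).1.not_gt h1
  · have hw0' : Q.eval w.2 ≠ 0 := by rwa [← sign_ne_zero, ← hw, sign_ne_zero]
    rw [hM.sign_eval_eq haw (fun c h1 h2 h3 => ?_) ha hw0,
      hN.sign_eval_eq hbw (fun c h1 h2 h3 => ?_) hb hw0', hw]
    · obtain ⟨d, hd⟩ := hrootQ c h3
      exact (hwZ _ hd ((hab _ hd).2.2 h1)).2.not_gt h2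
    · obtain ⟨d, hd⟩ := hrootP c h3
      exact (hwZ _ hd h1).1.not_gt h2

end IsMatching

/-! ### Matching the roots of a closed family of polynomials -/

variable {R : Type*} [CommRing R] (φ : R →+* M) (ψ : R →+* N)

/-- The matching `Z` consists of roots of members of `T`, contains all of them, and determines the
signs of the members of `T`. Here the coefficients of a polynomial over `R` are read in `M` through
`φ` and in `N` through `ψ`. Members that vanish identically in `M` or `N` have no roots in this
sense. -/
structure MatchesRoots (T : Finset R[X]) (Z : Set (M × N)) : Prop extends IsMatching Z where
  sign_eq : ∀ a b, SameCut Z a b → ∀ p ∈ T,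
    sign ((p.map φ).eval a) = sign ((p.map ψ).eval b)
  exists_of_root_left : ∀ p ∈ T, p.map φ ≠ 0 → ∀ a, (p.map φ).eval a = 0 → ∃ b, (a, b) ∈ Z
  exists_of_root_right : ∀ p ∈ T, p.map ψ ≠ 0 → ∀ b, (p.map ψ).eval b = 0 → ∃ a, (a, b) ∈ Z
  exists_root : ∀ z ∈ Z, ∃ q ∈ T, φ q.leadingCoeff ≠ 0 ∧ (q.map φ).eval z.1 = 0

variable {φ ψ}

theorem map_eraseLead_of_leadingCoeff {S : Type*} [CommRing S] (f : R →+* S) {p : R[X]}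
    (h : f p.leadingCoeff = 0) : p.eraseLead.map f = p.map f := by
  have := congrArg (map f) p.eraseLead_add_C_mul_X_pow
  simpa only [Polynomial.map_add, Polynomial.map_mul, map_C, h, C_0, zero_mul, add_zero] using this

theorem map_derivative_ne_zero {K : Type*} [Field K] [CharZero K] (f : R →+* K) {p : R[X]}
    (h : (p.map f).natDegree ≠ 0) : p.derivative.map f ≠ 0 := by
  rwa [← derivative_map, Ne, derivative_eq_zero]

/-- A root of `q` is a place where the sign of `p` is determined by the sign of the pseudo-remainder
of `p` modulo `q`. -/
theorem sign_eval_eq_of_pseudoRem {p q : R[X]} (hq : 1 ≤ q.natDegree)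
    (hlc : sign (φ q.leadingCoeff) = sign (ψ q.leadingCoeff)) (hlc0 : φ q.leadingCoeff ≠ 0)
    {a : M} {b : N} (ha : (q.map φ).eval a = 0) (hb : (q.map ψ).eval b = 0)
    (hrem : sign (((pseudoRem p q).map φ).eval a) = sign (((pseudoRem p q).map ψ).eval b)) :
    sign ((p.map φ).eval a) = sign ((p.map ψ).eval b) := by
  obtain ⟨k, s, h⟩ := pseudoRem_spec p q hq
  have h1 := congrArg (fun f => (f.map φ).eval a) h
  have h2 := congrArg (fun f => (f.map ψ).eval b) h
  simp only [Polynomial.map_mul, map_C, eval_mul, eval_C, Polynomial.map_add, eval_add, ha, hb,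
    zero_mul, zero_add] at h1 h2
  rw [← h1, ← h2, sign_mul, sign_mul, map_pow φ, map_pow ψ, sign_pow, sign_pow, hlc] at hrem
  refine mul_left_cancel₀ (pow_ne_zero k ?_) hrem
  rwa [← hlc, sign_ne_zero]

theorem exists_matchesRoots (hM : PolynomialIVT M) (hN : PolynomialIVT N) {T : Finset R[X]}
    (hT : IsClosedFamily T) (hlc : ∀ p ∈ T, sign (φ p.leadingCoeff) = sign (ψ p.leadingCoeff)) :
    ∃ Z, MatchesRoots φ ψ T Z := by
  classical
  revert hT hlc
  refine Finset.induction_on_max_value natDegree T ?_ ?_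
  · exact fun _ _ => ⟨∅, IsMatching.empty, by simp, by simp, by simp, by simp⟩
  · intro p T hpT hmax ih hT hlc
    have hmem : ∀ r ∈ insert p T, r.natDegree < p.natDegree → r ∈ T := by
      intro r hr hlt
      refine (Finset.mem_insert.1 hr).resolve_left ?_
      rintro rfl
      exact lt_irrefl _ hlt
    have hT' : IsClosedFamily T := by
      intro q hq h1
      obtain ⟨h2, h3, h4⟩ := hT q (Finset.mem_insert_of_mem hq) h1
      have hle := hmax q hq
      exact ⟨hmem _ h2 ((natDegree_derivative_lt (by omega)).trans_le hle),
        hmem _ h3 ((natDegree_eraseLead_lt_of_one_le h1).trans_le hle),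
        fun r hr hrq => hmem _ (h4 r (Finset.mem_insert_of_mem hr) hrq)
          ((natDegree_pseudoRem_lt r q h1).trans_le hle)⟩
    obtain ⟨Z, hZ⟩ := ih hT' fun q hq => hlc q (Finset.mem_insert_of_mem hq)
    have hp := hlc p (Finset.mem_insert_self p T)
    by_cases hdeg : p.natDegree = 0
    · rw [eq_C_of_natDegree_eq_zero hdeg] at hp ⊢
      simp only [leadingCoeff_C] at hp
      refine ⟨Z, hZ.toIsMatching, ?_, ?_, ?_, ?_⟩
      · simpa [hp] using hZ.sign_eq
      · simpa +contextual using hZ.exists_of_root_left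
      · simpa +contextual using hZ.exists_of_root_right
      · intro z hz
        obtain ⟨q, hq, h⟩ := hZ.exists_root z hz
        exact ⟨q, Finset.mem_insert_of_mem hq, h⟩
    have hdeg : 1 ≤ p.natDegree := Nat.one_le_iff_ne_zero.2 hdeg
    obtain ⟨hder, hlead, hrem⟩ := hT p (Finset.mem_insert_self p T) hdeg
    by_cases hlc0 : φ p.leadingCoeff = 0
    · -- The leading term vanishes, so that `p` can be replaced by `p.eraseLead`.
      have hlc0' : ψ p.leadingCoeff = 0 := by
        rwa [hlc0, sign_zero, eq_comm, sign_eq_zero_iff] at hp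
      have hmem' := hmem _ hlead (natDegree_eraseLead_lt_of_one_le hdeg)
      have h1 := map_eraseLead_of_leadingCoeff φ hlc0
      have h2 := map_eraseLead_of_leadingCoeff ψ hlc0'
      refine ⟨Z, hZ.toIsMatching, fun a b hab q hq => ?_, fun q hq => ?_, fun q hq => ?_,
        fun z hz => ?_⟩
      · rcases Finset.mem_insert.1 hq with rfl | hq
        · rw [← h1, ← h2]
          exact hZ.sign_eq a b hab _ hmem'
        · exact hZ.sign_eq a b hab q hq
      · rcases Finset.mem_insert.1 hq with rfl | hq
        · rw [← h1]
          exact hZ.exists_of_root_left _ hmem'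
        · exact hZ.exists_of_root_left q hq
      · rcases Finset.mem_insert.1 hq with rfl | hq
        · rw [← h2]
          exact hZ.exists_of_root_right _ hmem'
        · exact hZ.exists_of_root_right q hq
      · obtain ⟨q, hq, h⟩ := hZ.exists_root z hz
        exact ⟨q, Finset.mem_insert_of_mem hq, h⟩
    · have hlc0' : ψ p.leadingCoeff ≠ 0 := by rwa [← sign_ne_zero, ← hp, sign_ne_zero]
      have hdP : (p.map φ).natDegree = p.natDegree :=
        natDegree_map_of_leadingCoeff_ne_zero φ hlc0
      have hdQ : (p.map ψ).natDegree = p.natDegree :=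
        natDegree_map_of_leadingCoeff_ne_zero ψ hlc0'
      have hmemd := hmem _ hder (natDegree_derivative_lt (by omega))
      have hsign : ∀ z ∈ Z, sign ((p.map φ).eval z.1) = sign ((p.map ψ).eval z.2) := by
        intro z hz
        obtain ⟨q, hq, hq0, hqz⟩ := hZ.exists_root z hz
        have hqlc := hlc q (Finset.mem_insert_of_mem hq)
        have hqz' : (q.map ψ).eval z.2 = 0 := by
          have := hZ.sign_eq _ _ (hZ.sameCut z hz) q hq
          rwa [hqz, sign_zero, eq_comm, sign_eq_zero_iff] at this
        have hq1 : 1 ≤ q.natDegree := by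
          by_contra h
          rw [eq_C_of_natDegree_eq_zero (by omega : q.natDegree = 0)] at hqz hq0
          simp at hqz hq0
          exact hq0 hqz
        refine sign_eval_eq_of_pseudoRem hq1 hqlc hq0 hqz hqz'
          (hZ.sign_eq _ _ (hZ.sameCut z hz) _ (hmem _ ?_ ?_))
        · exact (hT q (Finset.mem_insert_of_mem hq) hq1).2.2 p (Finset.mem_insert_self p T)
            (hmax q hq)
        · exact (natDegree_pseudoRem_lt p q hq1).trans_le (hmax q hq)
      obtain ⟨Z', hsub, hZ', hnew, hrootP, hrootQ, hsignZ'⟩ :=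
        hZ.exists_extension hM hN (P := p.map φ) (Q := p.map ψ)
          (by rintro h; rw [h, natDegree_zero] at hdP; omega)
          (by rintro h; rw [h, natDegree_zero] at hdQ; omega) (hdP.trans hdQ.symm)
          (by rw [leadingCoeff_map_of_leadingCoeff_ne_zero φ hlc0,
                leadingCoeff_map_of_leadingCoeff_ne_zero ψ hlc0', hp]) hsign
          (by
            rw [derivative_map]
            exact hZ.exists_of_root_left _ hmemd (map_derivative_ne_zero φ (by omega)))
          (by
            rw [derivative_map]
            exact hZ.exists_of_root_right _ hmemd (map_derivative_ne_zero ψ (by omega)))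
      refine ⟨Z', hZ', fun a b hab q hq => ?_, fun q hq h a ha => ?_, fun q hq h b hb => ?_,
        fun z hz => ?_⟩
      · rcases Finset.mem_insert.1 hq with rfl | hq
        · exact hsignZ' a b hab
        · exact hZ.sign_eq a b (hab.mono hsub) q hq
      · rcases Finset.mem_insert.1 hq with rfl | hq
        · exact hrootP a ha
        · obtain ⟨b, hb⟩ := hZ.exists_of_root_left q hq h a ha
          exact ⟨b, hsub hb⟩
      · rcases Finset.mem_insert.1 hq with rfl | hq
        · exact hrootQ b hb
        · obtain ⟨a, ha⟩ := hZ.exists_of_root_right q hq h b hb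
          exact ⟨a, hsub ha⟩
      · rcases hnew z hz with hz | hz
        · obtain ⟨q, hq, h⟩ := hZ.exists_root z hz
          exact ⟨q, Finset.mem_insert_of_mem hq, h⟩
        · exact ⟨p, Finset.mem_insert_self p T, hlc0, hz.1⟩

end Matching

/-- The back-and-forth property: for every finite set `S` of polynomials there is a finite set `S'`
of elements of `R` whose signs in `M` and `N` guarantee that every point of `M` has a counterpart in
`N` where the members of `S` have the same signs, and conversely. The set `S'` does not depend on
`M` and `N`. -/
theorem exists_finset_back_and_forth {R : Type*} [CommRing R] (S : Finset R[X]) :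
    ∃ S' : Finset R, ∀ {M N : Type} [Field M] [LinearOrder M] [IsStrictOrderedRing M]
      [Field N] [LinearOrder N] [IsStrictOrderedRing N], PolynomialIVT M → PolynomialIVT N →
      ∀ (φ : R →+* M) (ψ : R →+* N), (∀ r ∈ S', sign (φ r) = sign (ψ r)) →
      (∀ a, ∃ b, ∀ p ∈ S, sign ((p.map φ).eval a) = sign ((p.map ψ).eval b)) ∧
      ∀ b, ∃ a, ∀ p ∈ S, sign ((p.map φ).eval a) = sign ((p.map ψ).eval b) := by
  classical
  obtain ⟨A, hSA, hA⟩ := exists_isClosedFamily S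
  refine ⟨A.image leadingCoeff, fun hM hN φ ψ h => ?_⟩
  obtain ⟨Z, hZ⟩ := exists_matchesRoots hM hN hA (φ := φ) (ψ := ψ)
    fun p hp => h _ (Finset.mem_image_of_mem _ hp)
  refine ⟨fun a => ?_, fun b => ?_⟩
  · obtain ⟨b, hb⟩ := hZ.exists_sameCut a
    exact ⟨b, fun p hp => hZ.sign_eq a b hb p (hSA hp)⟩
  · obtain ⟨a, ha⟩ := hZ.swap.exists_sameCut b
    exact ⟨a, fun p hp => hZ.sign_eq a b ha.swap p (hSA hp)⟩

/-! ### Ordered fields as structures -/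

section Structures

open FirstOrder FirstOrder.Language FirstOrder.Language.Structure

/-- The function symbols are interpreted in `K` by its field operations. -/
class CompatibleField (K : Type*) [Field K] [orderedFieldLang.Structure K] : Prop where
  funMap_add : ∀ v : Fin 2 → K, funMap (L := orderedFieldLang) ringFunc.add v = v 0 + v 1
  funMap_mul : ∀ v : Fin 2 → K, funMap (L := orderedFieldLang) ringFunc.mul v = v 0 * v 1
  funMap_neg : ∀ v : Fin 1 → K, funMap (L := orderedFieldLang) ringFunc.neg v = -v 0
  funMap_zero : ∀ v : Fin 0 → K, funMap (L := orderedFieldLang) ringFunc.zero v = 0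
  funMap_one : ∀ v : Fin 0 → K, funMap (L := orderedFieldLang) ringFunc.one v = 1

/-- The interpretation of the symbol `<`. -/
def StructLT {K : Type*} [orderedFieldLang.Structure K] (a b : K) : Prop :=
  RelMap (L := orderedFieldLang) OrdRel.lt ![a, b]

/-- The structure on `K` is given by its field operations and its order. -/
class CompatibleOrderedField (K : Type*) [Field K] [LinearOrder K]
    [orderedFieldLang.Structure K] : Prop extends CompatibleField K where
  structLT_iff : ∀ a b : K, StructLT a b ↔ a < b

@[simp]
theorem realize_ltF {K : Type*} [orderedFieldLang.Structure K] {α : Type*} (v : α → K) {n : ℕ}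
    (s t : orderedFieldLang.Term (α ⊕ Fin n)) (xs : Fin n → K) :
    (ltF s t).Realize v xs ↔ StructLT (s.realize (Sum.elim v xs)) (t.realize (Sum.elim v xs)) :=
  BoundedFormula.realize_rel₂

section Realize

open CompatibleField

variable {K : Type*} [Field K] [orderedFieldLang.Structure K] [CompatibleField K]
  {α : Type*} (v : α → K)

@[simp]
theorem realize_add (s t : orderedFieldLang.Term α) :
    (s + t).realize v = s.realize v + t.realize v :=
  funMap_add _

@[simp]
theorem realize_mul (s t : orderedFieldLang.Term α) :
    (s * t).realize v = s.realize v * t.realize v :=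
  funMap_mul _

@[simp]
theorem realize_zero : (0 : orderedFieldLang.Term α).realize v = 0 :=
  funMap_zero _

@[simp]
theorem realize_one : (1 : orderedFieldLang.Term α).realize v = 1 :=
  funMap_one _

@[simp]
theorem realize_powTerm (t : orderedFieldLang.Term α) (n : ℕ) :
    (powTerm t n).realize v = t.realize v ^ n := by
  induction n with
  | zero => simp [powTerm]
  | succ n ih => simp [powTerm, ih, pow_succ]

theorem realize_list_sum (l : List (orderedFieldLang.Term α)) :
    l.sum.realize v = (l.map fun t => t.realize v).sum := by
  induction l with
  | nil => simp
  | cons t l ih => simp [ih]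

@[simp]
theorem realize_polyTerm {m : ℕ} (a : Fin (m + 1) → orderedFieldLang.Term α)
    (t : orderedFieldLang.Term α) :
    (polyTerm a t).realize v = ∑ i, (a i).realize v * t.realize v ^ (i : ℕ) := by
  rw [polyTerm, realize_list_sum, List.map_ofFn, List.sum_ofFn]
  simp

/-- The content of each order axiom, for the relation interpreting `<`. -/
def OrderAxiom.Holds (K : Type*) [Field K] [orderedFieldLang.Structure K] : OrderAxiom → Prop
  | .irrefl => ∀ a : K, ¬StructLT a a
  | .trans => ∀ a b c : K, StructLT a b → StructLT b c → StructLT a c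
  | .trichotomy => ∀ a b : K, (StructLT a b ∨ a = b) ∨ StructLT b a
  | .addLtAdd => ∀ a b c : K, StructLT a b → StructLT (a + c) (b + c)
  | .mulPos => ∀ a b : K, StructLT 0 a → StructLT 0 b → StructLT 0 (a * b)

theorem OrderAxiom.realize_toSentence (ax : OrderAxiom) :
    K ⊨ ax.toSentence ↔ ax.Holds K := by
  cases ax <;> simp [OrderAxiom.toSentence, OrderAxiom.Holds, Sentence.Realize, Formula.Realize,
    Fin.snoc]

end Realize

theorem polynomialIVT_iff {K : Type*} [Field K] [LinearOrder K] :
    PolynomialIVT K ↔ ∀ (m : ℕ) (a : Fin (m + 1) → K) (u v : K), u < v →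
      (∑ i, a i * u ^ (i : ℕ)) * (∑ i, a i * v ^ (i : ℕ)) < 0 →
      ∃ x, u < x ∧ x < v ∧ ∑ i, a i * x ^ (i : ℕ) = 0 := by
  constructor
  · intro h m a u v huv hlt
    have := h (∑ i, C (a i) * X ^ (i : ℕ)) u v huv
    simp only [eval_finsetSum, eval_mul, eval_C, eval_pow, eval_X] at this
    exact this hlt
  · intro h p u v huv hlt
    have hp : ∀ x, ∑ i : Fin (p.natDegree + 1), p.coeff i * x ^ (i : ℕ) = p.eval x := fun x => by
      rw [eval_eq_sum_range, Fin.sum_univ_eq_sum_range (fun i => p.coeff i * x ^ i)]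
    have := h p.natDegree (fun i => p.coeff i) u v huv
    simp only [hp] at this
    exact this hlt

theorem realize_ivtSentence {K : Type*} [Field K] [LinearOrder K] [orderedFieldLang.Structure K]
    [CompatibleOrderedField K] (m : ℕ) :
    K ⊨ ivtSentence m ↔ ∀ (a : Fin (m + 1) → K) (u v : K), u < v →
      (∑ i, a i * u ^ (i : ℕ)) * (∑ i, a i * v ^ (i : ℕ)) < 0 →
      ∃ x, u < x ∧ x < v ∧ ∑ i, a i * x ^ (i : ℕ) = 0 := by
  -- The sentence read off directly, with all its universally quantified variables in one tuple.
  have key : K ⊨ ivtSentence m ↔ ∀ xs : Fin (m + 3) → K,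
      xs ⟨m + 1, by omega⟩ < xs ⟨m + 2, by omega⟩ →
      (∑ i : Fin (m + 1), xs ⟨i, by omega⟩ * xs ⟨m + 1, by omega⟩ ^ (i : ℕ)) *
        (∑ i : Fin (m + 1), xs ⟨i, by omega⟩ * xs ⟨m + 2, by omega⟩ ^ (i : ℕ)) < 0 →
      ∃ x, xs ⟨m + 1, by omega⟩ < x ∧ x < xs ⟨m + 2, by omega⟩ ∧
        ∑ i : Fin (m + 1), xs ⟨i, by omega⟩ * x ^ (i : ℕ) = 0 := by
    have hs : ∀ (xs : Fin (m + 3) → K) (x : K) (i : ℕ) (hi : i < m + 3),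
        (Fin.snoc xs x : Fin (m + 4) → K) ⟨i, by omega⟩ = xs ⟨i, hi⟩ := fun xs x i hi => by
      simp [Fin.snoc, hi]
    have hl : ∀ (xs : Fin (m + 3) → K) (x : K),
        (Fin.snoc xs x : Fin (m + 4) → K) ⟨m + 3, by omega⟩ = x := fun xs x => by
      simp [Fin.snoc]
    have hi : ∀ i : Fin (m + 1), (i : ℕ) < m + 3 := fun i => by omega
    simp only [ivtSentence, Sentence.Realize, BoundedFormula.realize_alls,
      BoundedFormula.realize_ex, BoundedFormula.realize_imp, BoundedFormula.realize_inf,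
      realize_ltF, realize_mul, realize_polyTerm, realize_zero, Term.realize_var, Sum.elim_inr,
      BoundedFormula.realize_bdEqual, CompatibleOrderedField.structLT_iff, hl,
      hs _ _ _ (hi _), hs _ _ (m + 1) (by omega), hs _ _ (m + 2) (by omega)]
    refine forall_congr' fun xs => ?_
    constructor
    · rintro ⟨x, hx⟩ h1 h2
      obtain ⟨⟨h3, h4⟩, h5⟩ := hx ⟨h1, h2⟩
      exact ⟨x, h3, h4, h5⟩
    · intro h
      -- The existential quantifier stands before the implication, so that an arbitrary point is a
      -- witness when the premise fails.
      by_contra hn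
      rw [not_exists] at hn
      obtain ⟨h1, h2⟩ := (Classical.not_imp.1 (hn 0)).1
      obtain ⟨x, h3, h4, h5⟩ := h h1 h2
      exact hn x fun _ => ⟨⟨h3, h4⟩, h5⟩
  rw [key]
  constructor
  · intro h a u v huv hlt
    have := h fun j => if hj : (j : ℕ) < m + 1 then a ⟨j, hj⟩ else if (j : ℕ) = m + 1 then u else v
    have hi : ∀ i : Fin (m + 1), (i : ℕ) < m + 1 := fun i => i.2
    simp only [hi, dite_true, lt_self_iff_false, dite_false, if_true,
      show ¬(m + 2 < m + 1) by omega, show ¬(m + 2 = m + 1) by omega, if_false] at this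
    exact this huv hlt
  · intro h xs
    exact h _ _ _

/-- A model of the theory carries a field structure and a linear order that induce its structure. -/
theorem exists_compatibleOrderedField (K : Type*) [orderedFieldLang.Structure K]
    (h : K ⊨ OF ∪ IVT) : ∃ (_ : Field K) (_ : LinearOrder K) (_ : IsStrictOrderedRing K),
      CompatibleOrderedField K ∧ PolynomialIVT K := by
  let _ := ringInclusion.reduct K
  have : ringInclusion.IsExpansionOn K := LHom.isExpansionOn_reduct _ _
  have hOF : K ⊨ OF := h.mono Set.subset_union_left
  have : K ⊨ Theory.field :=
    (LHom.onTheory_model ringInclusion Theory.field).1 (hOF.mono Set.subset_union_left)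
  let _ := FirstOrder.Field.fieldOfModelField K
  let _ := FirstOrder.Field.compatibleRingOfModelField K
  have hf : CompatibleField K :=
    { funMap_add := FirstOrder.Ring.CompatibleRing.funMap_add
      funMap_mul := FirstOrder.Ring.CompatibleRing.funMap_mul
      funMap_neg := FirstOrder.Ring.CompatibleRing.funMap_neg
      funMap_zero := FirstOrder.Ring.CompatibleRing.funMap_zero
      funMap_one := FirstOrder.Ring.CompatibleRing.funMap_one }
  have hax : ∀ ax : OrderAxiom, ax.Holds K := fun ax =>
    ax.realize_toSentence.1 (hOF.realize_of_mem _ (.inr ⟨ax, rfl⟩))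
  have hirrefl := hax .irrefl
  have htrans := hax .trans
  have htri := hax .trichotomy
  have hadd := hax .addLtAdd
  have hmul := hax .mulPos
  simp only [OrderAxiom.Holds] at hirrefl htrans htri hadd hmul
  have : IsStrictTotalOrder K StructLT :=
    { irrefl := hirrefl
      trans := htrans
      trichotomous := fun a b h1 h2 => ((htri a b).resolve_right h2).resolve_left h1 }
  classical
  let _ : LinearOrder K := linearOrderOfSTO StructLT
  have hlt : ∀ a b : K, StructLT a b ↔ a < b := fun a b => Iff.rfl
  simp only [hlt] at hadd hmul
  have : IsOrderedAddMonoid K :=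
    { add_le_add_left := fun a b hab c => by
        rcases hab.eq_or_lt with rfl | hab
        · exact le_rfl
        · exact (hadd a b c hab).le }
  have : ZeroLEOneClass K := ⟨by
    by_contra h
    have h1 : (0 : K) < -1 := neg_pos.2 (not_le.1 h)
    have h2 := hmul _ _ h1 h1
    rw [neg_mul_neg, one_mul] at h2
    exact h h2.le⟩
  have hs : IsStrictOrderedRing K := .of_mul_pos fun a b => hmul a b
  have hc : CompatibleOrderedField K := { structLT_iff := hlt }
  exact ⟨_, _, hs, hc, polynomialIVT_iff.2 fun m =>
    (realize_ivtSentence m).1 (h.realize_of_mem _ (.inr ⟨m, rfl⟩))⟩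

noncomputable instance : orderedFieldLang.Structure ℝ where
  funMap := fun {n} f => match n, f with
    | _, .add => fun v => v 0 + v 1
    | _, .mul => fun v => v 0 * v 1
    | _, .neg => fun v => -v 0
    | _, .zero => fun _ => 0
    | _, .one => fun _ => 1
  RelMap := fun {n} r => match n, r with
    | _, .lt => fun v => v 0 < v 1

instance : CompatibleOrderedField ℝ where
  funMap_add _ := rfl
  funMap_mul _ := rfl
  funMap_neg _ := rfl
  funMap_zero _ := rfl
  funMap_one _ := rfl
  structLT_iff _ _ := Iff.rfl

theorem polynomialIVT_real : PolynomialIVT ℝ := by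
  intro p u v huv h
  have hc : ContinuousOn (fun x => p.eval x) (Set.Icc u v) := p.continuous.continuousOn
  rcases mul_neg_iff.1 h with ⟨h1, h2⟩ | ⟨h1, h2⟩
  · obtain ⟨x, hx, h0⟩ := intermediate_value_Ioo' huv.le hc ⟨h2, h1⟩
    exact ⟨x, hx.1, hx.2, h0⟩
  · obtain ⟨x, hx, h0⟩ := intermediate_value_Ioo huv.le hc ⟨h1, h2⟩
    exact ⟨x, hx.1, hx.2, h0⟩

theorem real_models : ℝ ⊨ OF ∪ IVT := by
  let : FirstOrder.Ring.CompatibleRing ℝ := FirstOrder.Ring.compatibleRingOfRing ℝ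
  have : ringInclusion.IsExpansionOn ℝ :=
    ⟨fun f _ => by cases f <;> rfl, fun r => r.elim⟩
  refine ⟨?_⟩
  rintro σ ((hσ | ⟨ax, rfl⟩) | ⟨m, rfl⟩)
  · exact ((LHom.onTheory_model ringInclusion Theory.field).2 inferInstance).realize_of_mem σ hσ
  · refine ax.realize_toSentence.2 ?_
    cases ax <;> simp only [OrderAxiom.Holds, CompatibleOrderedField.structLT_iff]
    · exact lt_irrefl
    · exact fun _ _ _ => lt_trans
    · exact fun a b => or_assoc.2 (lt_trichotomy a b)
    · exact fun a b c h => add_lt_add_left h c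
    · exact fun _ _ => mul_pos
  · exact (realize_ivtSentence m).2 (polynomialIVT_iff.1 polynomialIVT_real m)

/-! ### Agreement of formulas -/

/-- The polynomial expressing a term in its variables. -/
noncomputable def termPoly {α : Type*} : orderedFieldLang.Term α → MvPolynomial α ℤ
  | .var i => MvPolynomial.X i
  | .func (l := 2) ringFunc.add ts => termPoly (ts 0) + termPoly (ts 1)
  | .func (l := 2) ringFunc.mul ts => termPoly (ts 0) * termPoly (ts 1)
  | .func (l := 1) ringFunc.neg ts => -termPoly (ts 0)
  | .func (l := 0) ringFunc.zero _ => 0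
  | .func (l := 0) ringFunc.one _ => 1

theorem aeval_termPoly {K : Type*} [Field K] [orderedFieldLang.Structure K]
    [CompatibleField K] {α : Type*} (t : orderedFieldLang.Term α) (v : α → K) :
    MvPolynomial.aeval v (termPoly t) = t.realize v := by
  induction t with
  | var i => simp [termPoly]
  | func f ts ih =>
    cases f
    · rw [termPoly, map_add, ih, ih]
      exact (CompatibleField.funMap_add (K := K) fun i => (ts i).realize v).symm
    · rw [termPoly, map_mul, ih, ih]
      exact (CompatibleField.funMap_mul (K := K) fun i => (ts i).realize v).symm
    · rw [termPoly, map_neg, ih]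
      exact (CompatibleField.funMap_neg (K := K) fun i => (ts i).realize v).symm
    · rw [termPoly, map_zero]
      exact (CompatibleField.funMap_zero (K := K) fun i => (ts i).realize v).symm
    · rw [termPoly, map_one]
      exact (CompatibleField.funMap_one (K := K) fun i => (ts i).realize v).symm

/-- A polynomial in `n + 1` variables as a polynomial in the last one over the ring of polynomials
in the others. -/
noncomputable def toLastVar (n : ℕ) :
    MvPolynomial (Fin (n + 1)) ℤ →ₐ[ℤ] (MvPolynomial (Fin n) ℤ)[X] :=
  MvPolynomial.aeval (Fin.snoc (fun i => C (MvPolynomial.X i)) X : Fin (n + 1) → _)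

theorem eval_map_toLastVar {K : Type*} [CommRing K] {n : ℕ} (x : Fin n → K) (a : K)
    (f : MvPolynomial (Fin (n + 1)) ℤ) :
    ((toLastVar n f).map (MvPolynomial.aeval x : MvPolynomial (Fin n) ℤ →ₐ[ℤ] K).toRingHom).eval a =
      MvPolynomial.aeval (Fin.snoc x a : Fin (n + 1) → K) f := by
  induction f using MvPolynomial.induction_on with
  | C c => simp [toLastVar]
  | add p q hp hq => rw [map_add, Polynomial.map_add, eval_add, hp, hq, map_add]
  | mul_X p i hp =>
    rw [map_mul, Polynomial.map_mul, eval_mul, hp, map_mul]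
    congr 1
    induction i using Fin.lastCases <;> simp [toLastVar]

/-- Tuples `x` in `M` and `y` in `N` at which all members of `S` have the same sign. -/
def SameSigns {n : ℕ} (S : Finset (MvPolynomial (Fin n) ℤ)) {M N : Type*} [CommRing M]
    [LinearOrder M] [CommRing N] [LinearOrder N] (x : Fin n → M) (y : Fin n → N) : Prop :=
  ∀ f ∈ S, sign (MvPolynomial.aeval x f) = sign (MvPolynomial.aeval y f)

theorem exists_finset_sameSigns_snoc {n : ℕ} (S : Finset (MvPolynomial (Fin (n + 1)) ℤ)) :
    ∃ S' : Finset (MvPolynomial (Fin n) ℤ), ∀ {M N : Type}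
      [Field M] [LinearOrder M] [IsStrictOrderedRing M]
      [Field N] [LinearOrder N] [IsStrictOrderedRing N], PolynomialIVT M → PolynomialIVT N →
      ∀ (x : Fin n → M) (y : Fin n → N), SameSigns S' x y →
        (∀ a, ∃ b, SameSigns S (Fin.snoc x a : Fin (n + 1) → M) (Fin.snoc y b : Fin (n + 1) → N)) ∧
        ∀ b, ∃ a, SameSigns S (Fin.snoc x a : Fin (n + 1) → M)
          (Fin.snoc y b : Fin (n + 1) → N) := by
  classical
  obtain ⟨S', h⟩ := exists_finset_back_and_forth (S.image (toLastVar n))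
  refine ⟨S', fun hM hN x y hxy => ?_⟩
  have := h hM hN (MvPolynomial.aeval x : MvPolynomial (Fin n) ℤ →ₐ[ℤ] _).toRingHom
    (MvPolynomial.aeval y : MvPolynomial (Fin n) ℤ →ₐ[ℤ] _).toRingHom hxy
  simp only [Finset.mem_image, forall_exists_index, and_imp, forall_apply_eq_imp_iff₂,
    eval_map_toLastVar] at this
  exact this

/-- Whether a formula holds is determined by the signs of finitely many integer polynomials,
uniformly in the ordered field. -/
theorem exists_finset_realize_iff {n : ℕ} (θ : orderedFieldLang.BoundedFormula Empty n) :
    ∃ S : Finset (MvPolynomial (Fin n) ℤ), ∀ {M N : Type}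
      [Field M] [LinearOrder M] [IsStrictOrderedRing M] [orderedFieldLang.Structure M]
      [CompatibleOrderedField M]
      [Field N] [LinearOrder N] [IsStrictOrderedRing N] [orderedFieldLang.Structure N]
      [CompatibleOrderedField N], PolynomialIVT M → PolynomialIVT N →
      ∀ (x : Fin n → M) (y : Fin n → N), SameSigns S x y →
        (θ.Realize default x ↔ θ.Realize default y) := by
  classical
  -- The polynomial of a term whose variables are all bound.
  have hterm : ∀ {n : ℕ} (t : orderedFieldLang.Term (Empty ⊕ Fin n)),
      ∃ f : MvPolynomial (Fin n) ℤ, ∀ {K : Type} [Field K]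
        [orderedFieldLang.Structure K] [CompatibleField K] (x : Fin n → K),
        t.realize (Sum.elim default x) = MvPolynomial.aeval x f := by
    intro n t
    refine ⟨MvPolynomial.rename (Sum.elim Empty.elim id) (termPoly t), fun x => ?_⟩
    rw [MvPolynomial.aeval_rename, ← aeval_termPoly]
    congr 2
    ext i
    rcases i with i | i
    · exact i.elim
    · rfl
  induction θ with
  | falsum => exact ⟨∅, fun _ _ _ _ _ => Iff.rfl⟩
  | equal s t =>
    obtain ⟨f, hf⟩ := hterm s
    obtain ⟨g, hg⟩ := hterm t
    refine ⟨{f - g}, fun _ _ x y hxy => ?_⟩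
    have := hxy (f - g) (by simp)
    simp only [BoundedFormula.Realize, hf, hg]
    rw [← sub_eq_zero, ← map_sub, ← sign_eq_zero_iff, this, sign_eq_zero_iff, map_sub, sub_eq_zero]
  | rel r ts =>
    cases r
    obtain ⟨f, hf⟩ := hterm (ts 0)
    obtain ⟨g, hg⟩ := hterm (ts 1)
    refine ⟨{g - f}, fun _ _ x y hxy => ?_⟩
    have := hxy (g - f) (by simp)
    have hr : BoundedFormula.rel OrdRel.lt ts = ltF (ts 0) (ts 1) := by
      simp only [ltF, Relations.boundedFormula₂, Relations.boundedFormula]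
      congr 1
      ext i
      fin_cases i <;> rfl
    rw [hr, realize_ltF, realize_ltF, CompatibleOrderedField.structLT_iff,
      CompatibleOrderedField.structLT_iff, hf, hg, hf, hg, ← sub_pos, ← map_sub,
      ← sign_eq_one_iff, this, sign_eq_one_iff, map_sub, sub_pos]
  | imp θ₁ θ₂ ih₁ ih₂ =>
    obtain ⟨S₁, h₁⟩ := ih₁
    obtain ⟨S₂, h₂⟩ := ih₂
    exact ⟨S₁ ∪ S₂, fun hM hN x y hxy => imp_congr
      (h₁ hM hN x y fun f hf => hxy f (Finset.mem_union_left _ hf))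
      (h₂ hM hN x y fun f hf => hxy f (Finset.mem_union_right _ hf))⟩
  | all θ ih =>
    obtain ⟨S, hS⟩ := ih
    obtain ⟨S', hS'⟩ := exists_finset_sameSigns_snoc S
    refine ⟨S', fun hM hN x y hxy => ?_⟩
    obtain ⟨h1, h2⟩ := hS' hM hN x y hxy
    simp only [BoundedFormula.realize_all]
    constructor
    · intro h b
      obtain ⟨a, ha⟩ := h2 b
      exact (hS hM hN _ _ ha).1 (h a)
    · intro h a
      obtain ⟨b, hb⟩ := h1 a
      exact (hS hM hN _ _ hb).2 (h b)

/-- With no variables there are only integer constants, whose signs are the same in all ordered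
fields. -/
theorem sameSigns_of_isEmpty {M N : Type*} [Field M] [LinearOrder M] [IsStrictOrderedRing M]
    [Field N] [LinearOrder N] [IsStrictOrderedRing N] (S : Finset (MvPolynomial (Fin 0) ℤ))
    (x : Fin 0 → M) (y : Fin 0 → N) : SameSigns S x y := by
  intro f _
  obtain ⟨c, rfl⟩ := MvPolynomial.C_surjective (Fin 0) f
  rw [MvPolynomial.aeval_C, MvPolynomial.aeval_C, algebraMap_int_eq, algebraMap_int_eq,
    eq_intCast, eq_intCast]
  rcases lt_trichotomy c 0 with h | rfl | h
  · rw [sign_neg (Int.cast_lt_zero.2 h), sign_neg (Int.cast_lt_zero.2 h)]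
  · simp
  · rw [sign_pos (Int.cast_pos.2 h), sign_pos (Int.cast_pos.2 h)]

end Structures

end OrderedFieldIVT

theorem mainTheorem1 : (OrderedFieldIVT.OF ∪ OrderedFieldIVT.IVT).IsComplete := by
  open OrderedFieldIVT in
  refine ⟨@FirstOrder.Language.Theory.Model.isSatisfiable _ _ ℝ _ _ real_models, fun θ => ?_⟩
  obtain ⟨S, hS⟩ := exists_finset_realize_iff θ
  have key : ∀ K : (OF ∪ IVT).ModelType, θ.Realize K ↔ θ.Realize ℝ := by
    intro K
    obtain ⟨_, _, _, _, hK⟩ := exists_compatibleOrderedField K K.is_model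
    exact hS hK polynomialIVT_real _ _ (sameSigns_of_isEmpty S _ _)
  by_cases h : θ.Realize ℝ
  · left
    exact FirstOrder.Language.Theory.models_sentence_iff.2 fun K => (key K).2 h
  · right
    refine FirstOrder.Language.Theory.models_sentence_iff.2 fun K => ?_
    exact (FirstOrder.Language.Sentence.realize_not K).2 fun h' => h ((key K).1 h')
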